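/- **Model.** There are $n$ processes with identifiers $1,\dots,n$ in a synchronous complete network with authenticated channels; in each round every process sends messages (a broadcast also reaches its sender) and then receives all messages sent to it in that round. At most $f$ processes, where $n\ge 3f+1$, are Byzantine: let $F$ be their set. Processes outside $F$ are correct and follow the protocol; processes in $F$ send arbitrary messages, possibly depending on the messages of the same round, except that they cannot forge signatures of correct processes: a signature of a correct process can occur in a Byzantine message only if it already occurred in a message sent by a correct process (in the same round at the latest). Let $L_n$ be the lattice of subsets of $\{1,\dots,n\}$ with union as join, and $E\subseteq L_n$ a set of allowed proposals. Every correct $p_i$ has an input $pro_i\in E$. **Provable gradecast** (sender $p_s$, epoch $e$, three rounds; the instances of all senders run in parallel). Round 1: $p_s$ broadcasts $M$; every process selects one message received from $p_s$. Round 2: it broadcasts that message, and then selects the message received from the largest set of distinct sources. Round 3: if that message was received from at least $n-f$ sources, it broadcasts it with its signature on (epoch, sender $p_s$, message). Then, among the correctly signed messages, it selects the message received from the largest set of distinct sources; it delivers it with rank $2$ if there are at least $n-f$ sources, keeping $n-f$ of these signatures as a *seen-all proof*, with rank $1$ (and no proof) if there are at least $f+1$ but fewer than $n-f$ sources, and otherwise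 delivers $\bot$ with rank $0$. **Admissibility.** A group is a string over $\{s,m\}$ (slave, master). A message $(pro,G',Proofs)$ carries an admissibility proof for a value $v$ and a group $G$ if, for each position $t<|G|$ with $G[t]=s$, its $Proofs$ contain a seen-all proof (signatures of at least $n-f$ processes), for a gradecast of epoch $t$, of a message that claims the group formed by the first $t$ characters of $G$, proposes $v$ (for $t=0$: whose proposal is exactly the single value $v$), and itself carries an admissibility proof for $v$ and that group of $t$ characters. **Algorithm GAC** (Grade And Classify). Process $p_i$ starts with proposal set $P=\{pro_i\}$, $G=\epsilon$, no proofs, $t_d=0$, $t_u=n$, $t_m=\lfloor n/2\rfloor$. In each epoch $e=0,1,\dots,\lfloor\log_2 n\rfloor+1$ it gradecasts $(P,G,Proofs)$. At the end of epoch $0$ it sets $G:=s$. At the end of an epoch $e\ge1$ let $V$ be the set of the $v\in E$ that are contained in the proposal of some message that was delivered with rank at least $1$, claims the group $G$, and carries an admissibility proof for $v$ and $G$. If $|V|\le t_m$, set $G:=G\cdot s$, $t_u:=t_m$; otherwise set $G:=G\cdot m$, $P:=V$, $t_d:=t_m$; then $t_m:=t_d+\lfloor (t_u-t_d)/2\rfloor$.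 At the end of each epoch it adds to $Proofs$, for each value of $P$ and each position of the new $G$ that is an $s$, a valid seen-all proof selected (if there is one) from those output by its gradecasts in this epoch or contained in the messages they delivered. After the last epoch it decides $dec_i=\bigcup_{v\in P}v$. Wherever the algorithm selects, ties are resolved arbitrarily. **Theorem.** For all $n\ge 3f+1$, all $E\subseteq L_n$, all $F$ with $|F|\le f$, all inputs, all ways of resolving the selections, and all behaviours of the Byzantine processes, GAC solves Byzantine lattice agreement on $L_n$: * Liveness and Stability: every correct process eventually outputs a decision, and never changes it; * Comparability: for all correct $p_i,p_j$, $dec_i\subseteq dec_j$ or $dec_j\subseteq dec_i$; * Inclusivity: $pro_i\subseteq dec_i$ for every correct $p_i$; * Non-Triviality: there is $B\subseteq E$ with $|B|\le |F|$ such that $dec_i\subseteq\bigcup (X\cup B)$ for every correct $p_i$, where $X$ is the set of inputs of the correct processes. Moreover, there is a function $T(n)=O(\log n)$, depending on $n$ only, such that in all these executions every correct process has decided after $T(n)$ rounds. -/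

import Mathlib

namespace ByzLA

/-! ### Synchronous message passing with Byzantine processes -/

/-- A synchronous protocol for `n` processes. In round `r = 0, 1, 2, …` a process first sends a
finite set of packets to each process (itself included) and then updates its state from the
packets received in that round; `rcv j` is the set of packets received over the authenticated
channel from process `j`. -/
structure Protocol (n : ℕ) (Input State Packet Output : Type) where
  init : Fin n → Input → State
  send : ℕ → Fin n → State → Fin n → Finset Packet
  receive : ℕ → Fin n → State → (Fin n → Finset Packet) → State
  output : State → Option Output

/-- The packets that process `i` sends to process `j` in a round, given the states `st` at the
beginning of the round: a process outside `F` follows the protocol, a process in `F` sends `byz`. -/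
def Protocol.traffic {n : ℕ} {Input State Packet Output : Type}
    (A : Protocol n Input State Packet Output) (F : Finset (Fin n))
    (byz : ℕ → Fin n → Fin n → Finset Packet) (st : Fin n → State) (r : ℕ) (i j : Fin n) :
    Finset Packet :=
  if i ∈ F then byz r i j else A.send r i (st i) j

/-- The states after `r` rounds, when the set of Byzantine processes is `F` and process `i ∈ F`
sends `byz r i j` to process `j` in round `r`. (The states of the processes in `F` play no role.) -/
def Protocol.run {n : ℕ} {Input State Packet Output : Type}
    (A : Protocol n Input State Packet Output) (F : Finset (Fin n))
    (byz : ℕ → Fin n → Fin n → Finset Packet) (input : Fin n → Input) : ℕ → Fin n → State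
  | 0 => fun i => A.init i (input i)
  | r + 1 => fun i =>
      A.receive r i (A.run F byz input r i)
        (fun j => A.traffic F byz (A.run F byz input r) r j i)

/-! ### Byzantine lattice agreement -/

/-- The properties of Byzantine lattice agreement for the correct processes (those outside `F`).
`out r p` is the decision value that `p` has output after `r` rounds, if any. -/
structure IsLatticeAgreement {n : ℕ} {V : Type} [SemilatticeSup V] [OrderBot V] [DecidableEq V]
    (E : Finset V) (F : Finset (Fin n)) (pro : Fin n → V) (out : ℕ → Fin n → Option V) :
    Prop where
  liveness : ∀ p ∉ F, ∃ r d, out r p = some d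
  stability : ∀ p ∉ F, ∀ r r' d, r ≤ r' → out r p = some d → out r' p = some d
  comparability : ∀ p ∉ F, ∀ q ∉ F, ∀ r r' d d', out r p = some d → out r' q = some d' →
    d ≤ d' ∨ d' ≤ d
  inclusivity : ∀ p ∉ F, ∀ r d, out r p = some d → pro p ≤ d
  nonTriviality : ∃ B : Finset V, B ⊆ E ∧ B.card ≤ F.card ∧
    ∀ p ∉ F, ∀ r d, out r p = some d → d ≤ ((Fᶜ.image pro) ∪ B).sup id

/-! ### Messages and signatures -/

inductive Role
  | slave
  | master
  deriving DecidableEq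

/-- A seen-all proof (with `M` the type of messages): signatures of the processes in `signers`
on `message`, as relayed in the gradecast instance of sender `source` in epoch `epoch`. -/
structure Certificate (n : ℕ) (M : Type) where
  epoch : ℕ
  source : Fin n
  message : M
  signers : Finset (Fin n)

/-- The content `(pro, G, Proofs)` of a gradecast. `proposal` is a set of elements of the lattice
of subsets of `Fin n`, and `group` is the string of roles of the sender. -/
inductive Message (n : ℕ) : Type
  | mk (proposal : Finset (Finset (Fin n))) (group : List Role)
      (proofs : List (Certificate n (Message n)))

abbrev SeenAll (n : ℕ) : Type := Certificate n (Message n)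

def Message.proposal {n : ℕ} : Message n → Finset (Finset (Fin n))
  | .mk p _ _ => p

def Message.group {n : ℕ} : Message n → List Role
  | .mk _ G _ => G

def Message.proofs {n : ℕ} : Message n → List (SeenAll n)
  | .mk _ _ P => P

/-- The signature of `signer` on `message`, relayed in the gradecast instance of sender `source`
in epoch `epoch`. -/
structure Signature (n : ℕ) where
  signer : Fin n
  epoch : ℕ
  source : Fin n
  message : Message n

/-- The signature `σ` occurs, at some depth, in a message. -/
inductive Message.HasSignature {n : ℕ} (σ : Signature n) : Message n → Prop
  | direct (M : Message n) (c : SeenAll n) : c ∈ M.proofs → σ.signer ∈ c.signers →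
      σ.epoch = c.epoch → σ.source = c.source → σ.message = c.message → HasSignature σ M
  | nested (M : Message n) (c : SeenAll n) : c ∈ M.proofs → HasSignature σ c.message →
      HasSignature σ M

/-- What is sent over the channels: in the first round of an epoch a process sends its own
message; in the second and third round it relays, in the instance of sender `s`, a message,
without a signature and with a signature respectively. -/
inductive Packet (n : ℕ) : Type
  | own (M : Message n)
  | relay (s : Fin n) (M : Message n)
  | signed (s : Fin n) (M : Message n) (σ : Signature n)

def Packet.HasSignature {n : ℕ} (σ : Signature n) : Packet n → Prop
  | .own M => M.HasSignature σ
  | .relay _ M => M.HasSignature σ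
  | .signed _ M τ => M.HasSignature σ ∨ τ = σ ∨ τ.message.HasSignature σ

/-- Signatures of correct processes cannot be forged: such a signature occurs in a packet of a
Byzantine process only if it occurs in a packet that a correct process has sent, in the same round
at the latest. Apart from that, Byzantine processes may send anything. -/
def Unforgeable {n : ℕ} {Input State Output : Type}
    (A : Protocol n Input State (Packet n) Output) (F : Finset (Fin n))
    (byz : ℕ → Fin n → Fin n → Finset (Packet n)) (input : Fin n → Input) : Prop :=
  ∀ r, ∀ i ∈ F, ∀ j, ∀ p ∈ byz r i j, ∀ σ : Signature n, p.HasSignature σ → σ.signer ∉ F →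
    ∃ r' ≤ r, ∃ i' ∉ F, ∃ j', ∃ p' ∈ A.send r' i' (A.run F byz input r' i') j',
      p'.HasSignature σ

/-! ### Provable gradecast -/

/-- A rule that resolves the instructions of the form "select one of …". -/
structure Selector where
  pick : ∀ {α : Type} (S : Finset α), S.Nonempty → S

/-- The result of a gradecast; `none` stands for `⊥`. -/
structure Graded (n : ℕ) where
  message : Option (Message n)
  rank : ℕ
  proof : Option (SeenAll n)

noncomputable section

/-- The sources from which `M` was received; `got j` is the set of messages received from `j`. -/
def sources {n : ℕ} (got : Fin n → Finset (Message n)) (M : Message n) : Finset (Fin n) :=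
  open Classical in Finset.univ.filter fun j => M ∈ got j

/-- The received messages that come from a largest set of distinct sources. -/
def leaders {n : ℕ} (got : Fin n → Finset (Message n)) : Finset (Message n) :=
  open Classical in
  (Finset.univ.biUnion got).filter fun M =>
    ∀ M' ∈ Finset.univ.biUnion got, (sources got M').card ≤ (sources got M).card

/-- A message received from a largest set of distinct sources, if anything was received. -/
def mostFrequent {n : ℕ} (sel : Selector) (got : Fin n → Finset (Message n)) :
    Option (Message n) :=
  open Classical in
  if h : (leaders got).Nonempty then some (sel.pick (leaders got) h).1 else none

def Packet.ownPart {n : ℕ} : Packet n → Finset (Message n)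
  | .own M => {M}
  | _ => ∅

def Packet.relayPart {n : ℕ} (s : Fin n) : Packet n → Finset (Message n)
  | .relay s' M => if s' = s then {M} else ∅
  | _ => ∅

/-- The message of a packet of the third round of epoch `e` in the instance of `s`, provided that
it is correctly signed by the process `j` from which the packet came. -/
def Packet.signedPart {n : ℕ} (e : ℕ) (s j : Fin n) : Packet n → Finset (Message n)
  | .signed s' M σ => open Classical in if s' = s ∧ σ = ⟨j, e, s, M⟩ then {M} else ∅
  | _ => ∅

def gotOwn {n : ℕ} (rcv : Fin n → Finset (Packet n)) (j : Fin n) : Finset (Message n) :=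
  open Classical in (rcv j).biUnion Packet.ownPart

def gotRelay {n : ℕ} (rcv : Fin n → Finset (Packet n)) (s j : Fin n) : Finset (Message n) :=
  open Classical in (rcv j).biUnion (Packet.relayPart s)

def gotSigned {n : ℕ} (rcv : Fin n → Finset (Packet n)) (e : ℕ) (s j : Fin n) :
    Finset (Message n) :=
  open Classical in (rcv j).biUnion (Packet.signedPart e s j)

/-- Receive phase of round 1, instance of `s`: select one message received from `s`. -/
def gradecastRcv1 {n : ℕ} (sel : Selector) (rcv : Fin n → Finset (Packet n)) (s : Fin n) :
    Option (Message n) :=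
  open Classical in
  if h : (gotOwn rcv s).Nonempty then some (sel.pick (gotOwn rcv s) h).1 else none

/-- Receive phase of round 2, instance of `s`: the most frequent relayed message, if it was
received from at least `n - f` sources. -/
def gradecastRcv2 {n : ℕ} (f : ℕ) (sel : Selector) (rcv : Fin n → Finset (Packet n))
    (s : Fin n) : Option (Message n) :=
  (mostFrequent sel (gotRelay rcv s)).filter
    fun M => decide (n - f ≤ (sources (gotRelay rcv s) M).card)

/-- Receive phase of round 3 of epoch `e`, instance of `s`: grade the most frequent correctly
signed message, and keep `n - f` signatures on it if its rank is 2. -/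
def gradecastRcv3 {n : ℕ} (f : ℕ) (sel : Selector) (rcv : Fin n → Finset (Packet n)) (e : ℕ)
    (s : Fin n) : Graded n :=
  match mostFrequent sel (gotSigned rcv e s) with
  | none => ⟨none, 0, none⟩
  | some M =>
      if h : n - f ≤ (sources (gotSigned rcv e s) M).card then
        ⟨some M, 2, some ⟨e, s, M,
          (sel.pick (Finset.powersetCard (n - f) (sources (gotSigned rcv e s) M))
            (Finset.powersetCard_nonempty.2 h)).1⟩⟩
      else if f + 1 ≤ (sources (gotSigned rcv e s) M).card then ⟨some M, 1, none⟩
      else ⟨none, 0, none⟩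

/-! ### Admissibility proofs -/

/-- A message of epoch `t` proposes `v`. In epoch 0 a proposal is a single value. -/
def Message.Proposes {n : ℕ} (M : Message n) (t : ℕ) (v : Finset (Fin n)) : Prop :=
  if t = 0 then M.proposal = {v} else v ∈ M.proposal

/-- `c` has signatures of `n - f` processes on a message that was gradecast in epoch `t`, by a
process claiming to be in the group given by the first `t` characters of `G`, and that
proposes `v`. -/
def Certifies {n : ℕ} (f : ℕ) (v : Finset (Fin n)) (G : List Role) (t : ℕ) (c : SeenAll n) :
    Prop :=
  c.epoch = t ∧ n - f ≤ c.signers.card ∧ c.message.group = G.take t ∧ c.message.Proposes t v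

/-- `M` carries an admissibility proof for the value `v` and the group `G`: for each prefix of `G`
ending with `slave`, say in position `t`, it contains a seen-all proof, from epoch `t` and a
sender in the group `G.take t`, of a message in which `v` was itself admissible for that group. -/
def Message.Carries {n : ℕ} (f : ℕ) (M : Message n) (v : Finset (Fin n)) (G : List Role) : Prop :=
  ∀ t, (_h : G[t]? = some Role.slave) →
    ∃ c ∈ M.proofs, Certifies f v G t c ∧ c.message.Carries f v (G.take t)
termination_by G.length
decreasing_by
  obtain ⟨h, -⟩ := List.getElem?_eq_some_iff.1 _h
  simp only [List.length_take]
  omega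

/-- `c` is a valid proof of `v` for the prefix of `G` ending in position `t`. -/
def ValidProof {n : ℕ} (f : ℕ) (v : Finset (Fin n)) (G : List Role) (t : ℕ) (c : SeenAll n) :
    Prop :=
  Certifies f v G t c ∧ c.message.Carries f v (G.take t)

/-! ### Grade and classify -/

structure State (n : ℕ) where
  /-- the current proposal, a set of values -/
  pro : Finset (Finset (Fin n))
  group : List Role
  proofs : List (SeenAll n)
  td : ℕ
  tu : ℕ
  tm : ℕ
  /-- per sender, the message selected in the running gradecast instance -/
  current : Fin n → Option (Message n)
  decision : Option (Finset (Fin n))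

def gacInit {n : ℕ} (input : Finset (Fin n)) : State n where
  pro := {input}
  group := []
  proofs := []
  td := 0
  tu := n
  tm := n / 2
  current := fun _ => none
  decision := none

/-- The set `V` of values in `E` that are admissible for group `G` in some message of `P` of
positive rank whose sender claims to be in `G`. -/
def gacFilter {n : ℕ} (f : ℕ) (E : Finset (Finset (Fin n))) (G : List Role)
    (P : Fin n → Graded n) : Finset (Finset (Fin n)) :=
  open Classical in
  E.filter fun v => ∃ s M, (P s).message = some M ∧ 0 < (P s).rank ∧ M.group = G ∧
    v ∈ M.proposal ∧ M.Carries f v G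

/-- The seen-all proofs in `P`: those output by the gradecasts, and those contained in the
delivered messages. -/
def availableProofs {n : ℕ} (P : Fin n → Graded n) : Finset (SeenAll n) :=
  open Classical in
  Finset.univ.biUnion fun s => (P s).proof.toFinset ∪
    match (P s).message with
    | none => ∅
    | some M => M.proofs.toFinset

/-- For each value `v` of the proposal and each prefix of the group `G` ending with `slave`,
select from `P` a valid proof. -/
def collectProofs {n : ℕ} (f : ℕ) (sel : Selector) (pro : Finset (Finset (Fin n)))
    (G : List Role) (P : Fin n → Graded n) : List (SeenAll n) :=
  open Classical in
  pro.toList.flatMap fun v => (List.range G.length).flatMap fun t =>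
    if G[t]? = some Role.slave then
      if h : ((availableProofs P).filter (ValidProof f v G t)).Nonempty then
        [(sel.pick _ h).1]
      else []
    else []

/-- The index of the last epoch, `⌊log₂ n⌋ + 1`. -/
def lastEpoch (n : ℕ) : ℕ := Nat.log 2 n + 1

/-- The update of a process at the end of epoch `e`, without the decision. -/
def gacClassify {n : ℕ} (f : ℕ) (E : Finset (Finset (Fin n))) (sel : Selector) (e : ℕ)
    (st : State n) (P : Fin n → Graded n) : State n :=
  if e = 0 then
    { st with
      group := st.group ++ [Role.slave]
      proofs := st.proofs ++ collectProofs f sel st.pro (st.group ++ [Role.slave]) P }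
  else if (gacFilter f E st.group P).card ≤ st.tm then
    { st with
      group := st.group ++ [Role.slave]
      proofs := st.proofs ++ collectProofs f sel st.pro (st.group ++ [Role.slave]) P
      tu := st.tm
      tm := st.td + (st.tm - st.td) / 2 }
  else
    { st with
      pro := gacFilter f E st.group P
      group := st.group ++ [Role.master]
      proofs := st.proofs ++
        collectProofs f sel (gacFilter f E st.group P) (st.group ++ [Role.master]) P
      td := st.tm
      tm := st.tm + (st.tu - st.tm) / 2 }

/-- The end of epoch `e`; after the last epoch the join of the proposal is decided. -/
def gacEndEpoch {n : ℕ} (f : ℕ) (E : Finset (Finset (Fin n))) (sel : Selector) (e : ℕ)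
    (st : State n) (P : Fin n → Graded n) : State n :=
  if e = lastEpoch n then
    { gacClassify f E sel e st P with
      decision := some ((gacClassify f E sel e st P).pro.sup id) }
  else gacClassify f E sel e st P

/-- Send phase of round `r`, which is round `r % 3 + 1` of epoch `r / 3`: packets sent by process
`i` to every process. -/
def gacSend {n : ℕ} (r : ℕ) (i : Fin n) (st : State n) : Finset (Packet n) :=
  open Classical in
  if lastEpoch n < r / 3 then ∅
  else if r % 3 = 0 then {Packet.own (Message.mk st.pro st.group st.proofs)}
  else Finset.univ.biUnion fun s =>
    match st.current s with
    | none => ∅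
    | some M =>
        if r % 3 = 1 then {Packet.relay s M} else {Packet.signed s M ⟨i, r / 3, s, M⟩}

def gacReceive {n : ℕ} (f : ℕ) (E : Finset (Finset (Fin n))) (sel : Selector) (r : ℕ)
    (st : State n) (rcv : Fin n → Finset (Packet n)) : State n :=
  if lastEpoch n < r / 3 then st
  else if r % 3 = 0 then { st with current := gradecastRcv1 sel rcv }
  else if r % 3 = 1 then { st with current := gradecastRcv2 f sel rcv }
  else gacEndEpoch f E sel (r / 3) st (gradecastRcv3 f sel rcv (r / 3))

/-- Grade And Classify for `n` processes, on the lattice of subsets of `Fin n` (`Fin n` standing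
for the first `n` natural numbers) with union as join, with failure bound `f` and set `E` of
allowed proposal values. In round `r`, process `i` makes its selections according to `sel i r`. -/
def gac (n f : ℕ) (E : Finset (Finset (Fin n))) (sel : Fin n → ℕ → Selector) :
    Protocol n (Finset (Fin n)) (State n) (Packet n) (Finset (Fin n)) where
  init := fun _ input => gacInit input
  send := fun r i st _ => gacSend r i st
  receive := fun r i st rcv => gacReceive f E (sel i r) r st rcv
  output := State.decision

end

end ByzLA

/-!
The proof combines two ideas: `n - f` signatures on a message prove that everybody has delivered
it, and classification is a binary search for the number of values that are admissible for a group.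

*Gradecast.* Any two sets of `n - f` processes share a correct one, so in one instance all correct
processes sign the same message (`signed_unique`). A message signed by more than `f` correct
processes is therefore the most frequent one everywhere, and is delivered with positive rank by
everybody (`delivered_of_signed`). By induction on the rounds, every signature of a correct process
that occurs anywhere is genuine (`genuineState`), so a seen-all proof contained in any message
shows that its message was delivered by everybody in the epoch of the proof
(`delivered_of_genuineProof`).

*Classification.* Call a value admissible for `G` if some message with genuine signatures carries
an admissibility proof for it. Then:

* the proposal of a correct process is always admissible for its group, by proofs that the process
  itself holds (`own_carries`); hence it passes the process's own filter, and proposals only grow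
  (`pro_mono`);
* if a value is admissible for a group extending `G·s`, every correct process of the group `G` has
  seen it pass its filter (`Admissible.mem_filtered`).

The second fact gives two consequences. If two processes separate at `G`, the final proposal of the
slave is contained in that of the master (`finalPro_subset_of_slave_of_master`). And the threshold
`tu` bounds the number of allowed values that are admissible for the group
(`card_admissibleValues_le`), because a slave has at most `tm` values in its filtered set. As the
proposal has more than `td` values and the gap `tu - td` is at most one after the last epoch
(`thresholds`), the final proposal is the set of all admissible values of the final group
(`finalPro_eq`), which two processes of the same group share.

Finally, every group starts with `s`, so an admissible value was proposed alone in epoch `0`, and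
each sender has at most one such value delivered (`card_initialValues_le`). With all senders this starts the bound by `tu = n`; with
the Byzantine ones it gives the set `B` of Non-Triviality.
-/

namespace ByzLA

/-! ### Selection of a most frequent message -/

section Selection

variable {n : ℕ}

@[simp]
theorem mem_sources {got : Fin n → Finset (Message n)} {M : Message n} {j : Fin n} :
    j ∈ sources got M ↔ M ∈ got j := by
  simp [sources]

theorem mostFrequent_max {sel : Selector} {got : Fin n → Finset (Message n)} {M : Message n}
    (h : mostFrequent sel got = some M) (M' : Message n) :
    (sources got M').card ≤ (sources got M).card := by
  classical
  unfold mostFrequent at h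
  split_ifs at h with hne
  obtain rfl := Option.some.inj h
  have hM := (sel.pick _ hne).2
  simp only [leaders, Finset.mem_filter] at hM
  by_cases hM' : M' ∈ Finset.univ.biUnion got
  · exact hM.2 M' (by convert hM')
  · have : sources got M' = ∅ := by
      ext j
      simp only [Finset.mem_biUnion, Finset.mem_univ, true_and, not_exists] at hM'
      simp [hM' j]
    simp [this]

theorem mostFrequent_ne_none {sel : Selector} {got : Fin n → Finset (Message n)} {M : Message n}
    {j : Fin n} (h : M ∈ got j) : mostFrequent sel got ≠ none := by
  classical
  have hne : (Finset.univ.biUnion got).Nonempty := ⟨M, by simpa using ⟨j, h⟩⟩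
  obtain ⟨M', hM', hmax⟩ := Finset.exists_max_image _ (fun M => (sources got M).card) hne
  have hl : (leaders got).Nonempty := by
    refine ⟨M', ?_⟩
    simp only [leaders, Finset.mem_filter]
    exact ⟨by convert hM', fun M'' h'' => hmax M'' (by convert h'')⟩
  simp [mostFrequent, hl]

theorem mostFrequent_eq_of_dominant {sel : Selector} {got : Fin n → Finset (Message n)}
    {M : Message n} (k : ℕ) (hM : k < (sources got M).card)
    (hother : ∀ M', M' ≠ M → (sources got M').card ≤ k) : mostFrequent sel got = some M := by
  obtain ⟨j, hj⟩ := Finset.card_pos.1 (Nat.zero_lt_of_lt hM)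
  obtain ⟨M', hM'⟩ := Option.ne_none_iff_exists'.1
    (mostFrequent_ne_none (sel := sel) (mem_sources.1 hj))
  by_cases h : M' = M
  · rw [hM', h]
  · have := mostFrequent_max hM' M
    have := hother M' h
    omega

@[simp]
theorem mem_gotOwn {rcv : Fin n → Finset (Packet n)} {j : Fin n} {M : Message n} :
    M ∈ gotOwn rcv j ↔ Packet.own M ∈ rcv j := by
  classical
  simp only [gotOwn, Finset.mem_biUnion]
  constructor
  · rintro ⟨p, hp, hM⟩
    cases p <;> simp_all [Packet.ownPart]
  · intro h
    exact ⟨_, h, by simp [Packet.ownPart]⟩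

@[simp]
theorem mem_gotRelay {rcv : Fin n → Finset (Packet n)} {s j : Fin n} {M : Message n} :
    M ∈ gotRelay rcv s j ↔ Packet.relay s M ∈ rcv j := by
  classical
  simp only [gotRelay, Finset.mem_biUnion]
  constructor
  · rintro ⟨p, hp, hM⟩
    cases p with
    | relay s' M' =>
      simp only [Packet.relayPart] at hM
      split_ifs at hM with h <;> simp_all
    | _ => simp [Packet.relayPart] at hM
  · intro h
    exact ⟨_, h, by simp [Packet.relayPart]⟩

@[simp]
theorem mem_gotSigned {rcv : Fin n → Finset (Packet n)} {e : ℕ} {s j : Fin n} {M : Message n} :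
    M ∈ gotSigned rcv e s j ↔ Packet.signed s M ⟨j, e, s, M⟩ ∈ rcv j := by
  classical
  simp only [gotSigned, Finset.mem_biUnion]
  constructor
  · rintro ⟨p, hp, hM⟩
    cases p with
    | signed s' M' σ =>
      simp only [Packet.signedPart] at hM
      split_ifs at hM with h
      · obtain ⟨rfl, rfl⟩ := h
        obtain rfl := Finset.mem_singleton.1 hM
        exact hp
      · simp at hM
    | _ => simp [Packet.signedPart] at hM
  · intro h
    exact ⟨_, h, by simp [Packet.signedPart]⟩

theorem own_mem_of_gradecastRcv1 {sel : Selector} {rcv : Fin n → Finset (Packet n)} {s : Fin n}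
    {M : Message n} (h : gradecastRcv1 sel rcv s = some M) : Packet.own M ∈ rcv s := by
  unfold gradecastRcv1 at h
  split_ifs at h with hne
  obtain rfl := Option.some.inj h
  exact mem_gotOwn.1 (sel.pick _ hne).2

theorem gradecastRcv1_eq {sel : Selector} {rcv : Fin n → Finset (Packet n)} {s : Fin n}
    {M : Message n} (h : rcv s = {Packet.own M}) : gradecastRcv1 sel rcv s = some M := by
  have hne : (gotOwn rcv s).Nonempty := ⟨M, by simp [h]⟩
  obtain ⟨M', hM'⟩ : ∃ M', gradecastRcv1 sel rcv s = some M' := by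
    simp [gradecastRcv1, hne]
  have := own_mem_of_gradecastRcv1 hM'
  rw [h, Finset.mem_singleton] at this
  cases this
  exact hM'

variable {f : ℕ} {sel : Selector} {rcv : Fin n → Finset (Packet n)} {s : Fin n} {M : Message n}

theorem card_of_gradecastRcv2 (h : gradecastRcv2 f sel rcv s = some M) :
    n - f ≤ (sources (gotRelay rcv s) M).card := by
  simpa using (Option.filter_eq_some_iff.1 h).2

theorem gradecastRcv2_eq (h : mostFrequent sel (gotRelay rcv s) = some M)
    (hc : n - f ≤ (sources (gotRelay rcv s) M).card) : gradecastRcv2 f sel rcv s = some M := by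
  rw [gradecastRcv2, h, Option.filter_some, if_pos (decide_eq_true hc)]

/-- A delivered message was correctly signed by more than `f` processes; this includes the case of
rank 2, as `n - f` exceeds `f`. -/
theorem card_of_gradecastRcv3 {e : ℕ} (hn : 3 * f + 1 ≤ n)
    (h : (gradecastRcv3 f sel rcv e s).message = some M) :
    f < (sources (gotSigned rcv e s) M).card := by
  unfold gradecastRcv3 at h
  split at h
  · simp at h
  · split_ifs at h with h1 h2
    · obtain rfl := Option.some.inj h
      omega
    · obtain rfl := Option.some.inj h
      omega

theorem gradecastRcv3_eq {e : ℕ}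
    (h : mostFrequent sel (gotSigned rcv e s) = some M)
    (hc : f < (sources (gotSigned rcv e s) M).card) :
    (gradecastRcv3 f sel rcv e s).message = some M ∧ 0 < (gradecastRcv3 f sel rcv e s).rank := by
  unfold gradecastRcv3
  split
  · simp_all
  · rename_i M' hM'
    obtain rfl : M' = M := by simpa [hM'] using h
    split_ifs with h1 h2
    · exact ⟨rfl, Nat.succ_pos _⟩
    · exact ⟨rfl, Nat.succ_pos _⟩
    · exact absurd hc h2

theorem gradecastRcv3_proof {e : ℕ} (h : mostFrequent sel (gotSigned rcv e s) = some M)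
    (hc : n - f ≤ (sources (gotSigned rcv e s) M).card) :
    ∃ T : Finset (Fin n), T.card = n - f ∧
      (gradecastRcv3 f sel rcv e s).proof = some ⟨e, s, M, T⟩ := by
  unfold gradecastRcv3
  split
  · simp_all
  · rename_i M' hM'
    obtain rfl : M' = M := by simpa [hM'] using h
    rw [dif_pos hc]
    exact ⟨_, (Finset.mem_powersetCard.1 (sel.pick _ _).2).2, rfl⟩

theorem of_gradecastRcv3_proof {e : ℕ} {c : SeenAll n}
    (h : (gradecastRcv3 f sel rcv e s).proof = some c) :
    c.epoch = e ∧ c.source = s ∧ (gradecastRcv3 f sel rcv e s).message = some c.message ∧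
      c.signers ⊆ sources (gotSigned rcv e s) c.message := by
  unfold gradecastRcv3 at h ⊢
  split at h
  · simp at h
  · split_ifs at h with h1
    obtain rfl := Option.some.inj h
    refine ⟨rfl, rfl, ?_, (Finset.mem_powersetCard.1 (sel.pick _ _).2).1⟩
    simp [h1]

end Selection

/-! ### Admissibility and the classification step -/

section Classification

variable {n f : ℕ}

theorem carries_iff {M : Message n} {v : Finset (Fin n)} {G : List Role} :
    M.Carries f v G ↔ ∀ t, G[t]? = some Role.slave → ∃ c ∈ M.proofs, ValidProof f v G t c := by
  rw [Message.Carries]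
  rfl

theorem carries_nil {M : Message n} {v : Finset (Fin n)} : M.Carries f v [] := by
  simp [carries_iff]

theorem validProof_append {v : Finset (Fin n)} {G H : List Role} {t : ℕ} {c : SeenAll n}
    (ht : t ≤ G.length) : ValidProof f v (G ++ H) t c ↔ ValidProof f v G t c := by
  simp [ValidProof, Certifies, List.take_append_of_le_length ht]

theorem Message.Carries.of_append {M : Message n} {v : Finset (Fin n)} {G H : List Role}
    (h : M.Carries f v (G ++ H)) : M.Carries f v G := by
  rw [carries_iff] at h ⊢
  intro t ht
  have htl := (List.getElem?_eq_some_iff.1 ht).1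
  obtain ⟨c, hc, hv⟩ := h t (by rwa [List.getElem?_append_left htl])
  exact ⟨c, hc, (validProof_append htl.le).1 hv⟩

@[simp]
theorem mem_availableProofs {P : Fin n → Graded n} {c : SeenAll n} :
    c ∈ availableProofs P ↔
      ∃ s, (P s).proof = some c ∨ ∃ M, (P s).message = some M ∧ c ∈ M.proofs := by
  classical
  simp only [availableProofs, Finset.mem_biUnion, Finset.mem_univ, true_and, Finset.mem_union,
    Option.mem_toFinset, Option.mem_def]
  refine exists_congr fun s => or_congr_right ?_
  cases (P s).message <;> simp

theorem mem_gacFilter {E : Finset (Finset (Fin n))} {G : List Role} {P : Fin n → Graded n}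
    {v : Finset (Fin n)} :
    v ∈ gacFilter f E G P ↔ v ∈ E ∧ ∃ s M, (P s).message = some M ∧ 0 < (P s).rank ∧
      M.group = G ∧ v ∈ M.proposal ∧ M.Carries f v G := by
  simp [gacFilter]

theorem mem_availableProofs_of_mem_collectProofs {sel : Selector}
    {pro : Finset (Finset (Fin n))} {G : List Role} {P : Fin n → Graded n} {c : SeenAll n}
    (h : c ∈ collectProofs f sel pro G P) : c ∈ availableProofs P := by
  classical
  simp only [collectProofs, List.mem_flatMap] at h
  obtain ⟨v, -, t, -, h⟩ := h
  split_ifs at h with h1 h2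
  · obtain rfl := List.mem_singleton.1 h
    exact (Finset.mem_filter.1 (sel.pick _ h2).2).1
  · simp at h
  · simp at h

theorem exists_mem_collectProofs {sel : Selector}
    {pro : Finset (Finset (Fin n))} {G : List Role} {P : Fin n → Graded n} {c : SeenAll n}
    {v : Finset (Fin n)} {t : ℕ} (hv : v ∈ pro) (ht : G[t]? = some Role.slave)
    (hc : c ∈ availableProofs P) (hval : ValidProof f v G t c) :
    ∃ c' ∈ collectProofs f sel pro G P, ValidProof f v G t c' := by
  classical
  have hne : ((availableProofs P).filter (ValidProof f v G t)).Nonempty :=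
    ⟨c, Finset.mem_filter.2 ⟨hc, hval⟩⟩
  refine ⟨(sel.pick _ hne).1, ?_, (Finset.mem_filter.1 (sel.pick _ hne).2).2⟩
  simp only [collectProofs, List.mem_flatMap]
  refine ⟨v, by simpa using hv, t, ?_, ?_⟩
  · exact List.mem_range.2 (List.getElem?_eq_some_iff.1 ht).1
  · rw [if_pos ht, dif_pos (by convert hne)]
    exact List.mem_singleton.2 rfl

variable {E : Finset (Finset (Fin n))} {sel : Selector} {e : ℕ} {st : State n}
  {P : Fin n → Graded n}

@[simp]
theorem gacEndEpoch_pro : (gacEndEpoch f E sel e st P).pro = (gacClassify f E sel e st P).pro := by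
  unfold gacEndEpoch; split <;> rfl

@[simp]
theorem gacEndEpoch_group :
    (gacEndEpoch f E sel e st P).group = (gacClassify f E sel e st P).group := by
  unfold gacEndEpoch; split <;> rfl

@[simp]
theorem gacEndEpoch_td : (gacEndEpoch f E sel e st P).td = (gacClassify f E sel e st P).td := by
  unfold gacEndEpoch; split <;> rfl

@[simp]
theorem gacEndEpoch_tu : (gacEndEpoch f E sel e st P).tu = (gacClassify f E sel e st P).tu := by
  unfold gacEndEpoch; split <;> rfl

@[simp]
theorem gacEndEpoch_tm : (gacEndEpoch f E sel e st P).tm = (gacClassify f E sel e st P).tm := by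
  unfold gacEndEpoch; split <;> rfl

@[simp]
theorem gacEndEpoch_current : (gacEndEpoch f E sel e st P).current = st.current := by
  unfold gacEndEpoch gacClassify; split_ifs <;> rfl

@[simp]
theorem gacEndEpoch_proofs : (gacEndEpoch f E sel e st P).proofs = st.proofs ++
    collectProofs f sel (gacClassify f E sel e st P).pro (gacClassify f E sel e st P).group P := by
  unfold gacEndEpoch gacClassify; split_ifs <;> rfl

theorem gacEndEpoch_decision : (gacEndEpoch f E sel e st P).decision =
    if e = lastEpoch n then some ((gacClassify f E sel e st P).pro.sup id) else st.decision := by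
  unfold gacEndEpoch gacClassify; split_ifs <;> rfl

end Classification

/-! ### Executions -/

/-- An execution of the algorithm: the allowed proposals, the selections, the Byzantine processes,
the inputs and the Byzantine messages, with the hypotheses made on them. -/
structure Execution (n f : ℕ) where
  E : Finset (Finset (Fin n))
  sel : Fin n → ℕ → Selector
  F : Finset (Fin n)
  input : Fin n → Finset (Fin n)
  byz : ℕ → Fin n → Fin n → Finset (Packet n)
  resilience : 3 * f + 1 ≤ n
  card_le : F.card ≤ f
  input_mem : ∀ p ∉ F, input p ∈ E
  unforgeable : Unforgeable (gac n f E sel) F byz input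

namespace Execution

variable {n f : ℕ} (X : Execution n f)

/-- The state of process `p` after `r` rounds. -/
noncomputable def state (r : ℕ) (p : Fin n) : State n :=
  (gac n f X.E X.sel).run X.F X.byz X.input r p

/-- The packets that process `p` receives in round `r`, by sender. -/
noncomputable def rcv (r : ℕ) (p j : Fin n) : Finset (Packet n) :=
  (gac n f X.E X.sel).traffic X.F X.byz (X.state r) r j p

/-- The message that process `p` gradecasts in epoch `e`. -/
noncomputable def own (e : ℕ) (p : Fin n) : Message n :=
  .mk (X.state (3 * e) p).pro (X.state (3 * e) p).group (X.state (3 * e) p).proofs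

/-- The message on which process `p` puts its signature in the instance of `s` in epoch `e`. -/
noncomputable def signed (e : ℕ) (p s : Fin n) : Option (Message n) :=
  (X.state (3 * e + 2) p).current s

/-- The results of the gradecasts of epoch `e` at process `p`, by sender. -/
noncomputable def delivered (e : ℕ) (p : Fin n) : Fin n → Graded n :=
  gradecastRcv3 f (X.sel p (3 * e + 2)) (X.rcv (3 * e + 2) p) e

/-- The set `V` that process `p` computes at the end of epoch `e`. -/
noncomputable def filtered (e : ℕ) (p : Fin n) : Finset (Finset (Fin n)) :=
  gacFilter f X.E (X.state (3 * e) p).group (X.delivered e p)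

variable {X}

theorem state_succ (r : ℕ) (p : Fin n) :
    X.state (r + 1) p = gacReceive f X.E (X.sel p r) r (X.state r p) (X.rcv r p) := rfl

theorem rcv_correct {r : ℕ} {p j : Fin n} (hj : j ∉ X.F) :
    X.rcv r p j = gacSend r j (X.state r j) := by
  simp [rcv, Protocol.traffic, hj, gac]

theorem gacSend_own {e : ℕ} (he : e ≤ lastEpoch n) (p : Fin n) (st : State n) :
    gacSend (3 * e) p st = {Packet.own (Message.mk st.pro st.group st.proofs)} := by
  have h1 : 3 * e / 3 = e := by omega
  have h2 : 3 * e % 3 = 0 := by omega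
  simp [gacSend, h1, h2, he.not_gt]

theorem mem_gacSend_relay {e : ℕ} (he : e ≤ lastEpoch n) {p : Fin n} {st : State n}
    {x : Packet n} :
    x ∈ gacSend (3 * e + 1) p st ↔ ∃ s M, st.current s = some M ∧ x = Packet.relay s M := by
  have h1 : (3 * e + 1) / 3 = e := by omega
  have h2 : (3 * e + 1) % 3 = 1 := by omega
  simp only [gacSend, h1, h2, he.not_gt, if_false, one_ne_zero, if_true, Finset.mem_biUnion,
    Finset.mem_univ, true_and]
  refine exists_congr fun s => ?_
  cases st.current s <;> simp

theorem mem_gacSend_signed {e : ℕ} (he : e ≤ lastEpoch n) {p : Fin n} {st : State n}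
    {x : Packet n} :
    x ∈ gacSend (3 * e + 2) p st ↔
      ∃ s M, st.current s = some M ∧ x = Packet.signed s M ⟨p, e, s, M⟩ := by
  have h1 : (3 * e + 2) / 3 = e := by omega
  have h2 : (3 * e + 2) % 3 = 2 := by omega
  simp only [gacSend, h1, h2, he.not_gt, if_false, Finset.mem_biUnion,
    Finset.mem_univ, true_and, OfNat.ofNat_ne_zero, OfNat.ofNat_ne_one]
  refine exists_congr fun s => ?_
  cases st.current s <;> simp

theorem state_of_lastEpoch_lt {r : ℕ} (hr : lastEpoch n < r / 3) (p : Fin n) :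
    X.state (r + 1) p = X.state r p := by
  simp [state_succ, gacReceive, hr]

theorem state_add_one {e : ℕ} (he : e ≤ lastEpoch n) (p : Fin n) :
    X.state (3 * e + 1) p = { X.state (3 * e) p with
      current := gradecastRcv1 (X.sel p (3 * e)) (X.rcv (3 * e) p) } := by
  have h1 : 3 * e / 3 = e := by omega
  have h2 : 3 * e % 3 = 0 := by omega
  simp [state_succ, gacReceive, h1, h2, he.not_gt]

theorem state_add_two {e : ℕ} (he : e ≤ lastEpoch n) (p : Fin n) :
    X.state (3 * e + 2) p = { X.state (3 * e) p with
      current := gradecastRcv2 f (X.sel p (3 * e + 1)) (X.rcv (3 * e + 1) p) } := by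
  have h1 : (3 * e + 1) / 3 = e := by omega
  have h2 : (3 * e + 1) % 3 = 1 := by omega
  rw [show 3 * e + 2 = (3 * e + 1) + 1 by rfl, state_succ]
  simp [gacReceive, h1, h2, he.not_gt, state_add_one he]

theorem state_next {e : ℕ} (he : e ≤ lastEpoch n) (p : Fin n) :
    X.state (3 * (e + 1)) p =
      gacEndEpoch f X.E (X.sel p (3 * e + 2)) e (X.state (3 * e + 2) p) (X.delivered e p) := by
  have h1 : (3 * e + 2) / 3 = e := by omega
  have h2 : (3 * e + 2) % 3 = 2 := by omega
  rw [show 3 * (e + 1) = (3 * e + 2) + 1 by ring, state_succ]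
  simp [gacReceive, h1, h2, he.not_gt, delivered]

/-! ### Provable gradecast -/

theorem exists_correct_of_lt_card {S : Finset (Fin n)} (h : f < S.card) :
    ∃ j ∈ S, j ∉ X.F := by
  by_contra! hS
  have := Finset.card_le_card (show S ⊆ X.F from hS)
  have := X.card_le
  omega

theorem lt_card_sdiff {S : Finset (Fin n)} (h : n - f ≤ S.card) : f < (S \ X.F).card := by
  have := Finset.le_card_sdiff X.F S
  have := X.card_le
  have := X.resilience
  omega

theorem le_card_compl : n - f ≤ (X.Fᶜ).card := by
  rw [Finset.card_compl, Fintype.card_fin]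
  have := X.card_le
  omega

variable {e : ℕ} {p q s j : Fin n} {M M' : Message n}

theorem mem_gotRelay_correct (he : e ≤ lastEpoch n) (hj : j ∉ X.F) :
    M ∈ gotRelay (X.rcv (3 * e + 1) p) s j ↔ (X.state (3 * e + 1) j).current s = some M := by
  rw [mem_gotRelay, rcv_correct hj, mem_gacSend_relay he]
  constructor
  · rintro ⟨s', M', h, h'⟩
    cases h'
    exact h
  · exact fun h => ⟨s, M, h, rfl⟩

theorem mem_gotSigned_correct (he : e ≤ lastEpoch n) (hj : j ∉ X.F) :
    M ∈ gotSigned (X.rcv (3 * e + 2) p) e s j ↔ X.signed e j s = some M := by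
  rw [mem_gotSigned, rcv_correct hj, mem_gacSend_signed he]
  constructor
  · rintro ⟨s', M', h, h'⟩
    cases h'
    exact h
  · exact fun h => ⟨s, M, h, rfl⟩

/-- Correct processes sign the same message: two sets of `n - f` sources share a correct one,
which relays a single message. -/
theorem signed_unique (he : e ≤ lastEpoch n) (h : X.signed e p s = some M)
    (h' : X.signed e q s = some M') : M = M' := by
  rw [signed, state_add_two he] at h h'
  have h1 := lt_card_sdiff (X := X) (card_of_gradecastRcv2 h)
  have h2 := card_of_gradecastRcv2 h'
  set S := sources (gotRelay (X.rcv (3 * e + 1) p) s) M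
  set S' := sources (gotRelay (X.rcv (3 * e + 1) q) s) M' with hS'
  obtain ⟨j, hj⟩ : ((S \ X.F) ∩ S').Nonempty := by
    rw [← Finset.card_pos]
    have := Finset.card_union_add_card_inter (S \ X.F) S'
    have hle := Finset.card_le_univ ((S \ X.F) ∪ S')
    rw [Fintype.card_fin] at hle
    omega
  simp only [Finset.mem_inter, Finset.mem_sdiff] at hj
  have e1 := (mem_gotRelay_correct he hj.1.2).1 (mem_sources.1 hj.1.1)
  have e2 := (mem_gotRelay_correct he hj.1.2).1 (mem_sources.1 hj.2)
  exact Option.some.inj (e1.symm.trans e2)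

/-- A message signed by more than `f` correct processes is the most frequent one everywhere. -/
theorem mostFrequent_signed (he : e ≤ lastEpoch n) {S : Finset (Fin n)} (hS : f < S.card)
    (h : ∀ j ∈ S, j ∉ X.F ∧ X.signed e j s = some M) (sel : Selector) :
    S ⊆ sources (gotSigned (X.rcv (3 * e + 2) p) e s) M ∧
      mostFrequent sel (gotSigned (X.rcv (3 * e + 2) p) e s) = some M := by
  have hsub : S ⊆ sources (gotSigned (X.rcv (3 * e + 2) p) e s) M := fun j hj =>
    mem_sources.2 ((mem_gotSigned_correct he (h j hj).1).2 (h j hj).2)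
  refine ⟨hsub, mostFrequent_eq_of_dominant f (hS.trans_le (Finset.card_le_card hsub)) ?_⟩
  -- A rival with more than `f` sources has a correct signer, so it is the same message.
  intro M' hM'
  by_contra! hlt
  obtain ⟨i, hi, hiF⟩ := exists_correct_of_lt_card (X := X) hlt
  obtain ⟨j, hj⟩ := Finset.card_pos.1 (Nat.zero_lt_of_lt hS)
  exact hM' (signed_unique he ((mem_gotSigned_correct he hiF).1 (mem_sources.1 hi)) (h j hj).2)

theorem delivered_of_signed (he : e ≤ lastEpoch n) {S : Finset (Fin n)} (hS : f < S.card)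
    (h : ∀ j ∈ S, j ∉ X.F ∧ X.signed e j s = some M) (p : Fin n) :
    (X.delivered e p s).message = some M ∧ 0 < (X.delivered e p s).rank := by
  obtain ⟨hsub, hm⟩ := mostFrequent_signed (p := p) he hS h (X.sel p (3 * e + 2))
  exact gradecastRcv3_eq hm (hS.trans_le (Finset.card_le_card hsub))

theorem signed_own (he : e ≤ lastEpoch n) (hs : s ∉ X.F) (p : Fin n) :
    X.signed e p s = some (X.own e s) := by
  have hrelay : ∀ j, (X.state (3 * e + 1) j).current s = some (X.own e s) := by
    intro j
    rw [state_add_one he]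
    exact gradecastRcv1_eq (by rw [rcv_correct hs, gacSend_own he]; rfl)
  have hsub : X.Fᶜ ⊆ sources (gotRelay (X.rcv (3 * e + 1) p) s) (X.own e s) := fun j hj =>
    mem_sources.2 ((mem_gotRelay_correct he (Finset.mem_compl.1 hj)).2 (hrelay j))
  have hcard := (le_card_compl (X := X)).trans (Finset.card_le_card hsub)
  rw [signed, state_add_two he]
  refine gradecastRcv2_eq (mostFrequent_eq_of_dominant f ?_ ?_) hcard
  · have := X.resilience
    omega
  · intro M' hM'
    by_contra! hlt
    obtain ⟨i, hi, hiF⟩ := exists_correct_of_lt_card (X := X) hlt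
    have := (mem_gotRelay_correct he hiF).1 (mem_sources.1 hi)
    exact hM' (Option.some.inj (this.symm.trans (hrelay i)))

theorem compl_signed_own (he : e ≤ lastEpoch n) (hs : s ∉ X.F) :
    f < (X.Fᶜ).card ∧ ∀ j ∈ X.Fᶜ, j ∉ X.F ∧ X.signed e j s = some (X.own e s) := by
  refine ⟨?_, fun j hj => ⟨Finset.mem_compl.1 hj, signed_own he hs j⟩⟩
  have := le_card_compl (X := X)
  have := X.resilience
  omega

theorem delivered_own (he : e ≤ lastEpoch n) (hs : s ∉ X.F) (p : Fin n) :
    (X.delivered e p s).message = some (X.own e s) ∧ 0 < (X.delivered e p s).rank :=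
  delivered_of_signed he (compl_signed_own he hs).1 (compl_signed_own he hs).2 p

/-- The gradecast of a correct sender outputs a seen-all proof. -/
theorem delivered_own_proof (he : e ≤ lastEpoch n) (hs : s ∉ X.F) (p : Fin n) :
    ∃ T : Finset (Fin n), T.card = n - f ∧
      (X.delivered e p s).proof = some ⟨e, s, X.own e s, T⟩ := by
  obtain ⟨hsub, hm⟩ := mostFrequent_signed (p := p) he (compl_signed_own he hs).1
    (compl_signed_own he hs).2 (X.sel p (3 * e + 2))
  exact gradecastRcv3_proof hm (le_card_compl.trans (Finset.card_le_card hsub))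

/-! ### Signatures of correct processes are genuine -/

variable (X) in
/-- A signature is genuine if its signer is Byzantine or has signed the message in the third round
of the epoch in question. The definition does not refer to the round in which the signature is seen:
a forged signature on what the process signs later would count as genuine, which does no harm. -/
def Genuine (σ : Signature n) : Prop :=
  σ.signer ∉ X.F → X.signed σ.epoch σ.signer σ.source = some σ.message

variable (X) in
/-- All signatures that occur in the message are genuine. -/
def GenuineMessage (M : Message n) : Prop := ∀ σ, M.HasSignature σ → X.Genuine σ

variable (X) in
/-- All signatures of the seen-all proof, and those occurring in its message, are genuine. -/
def GenuineProof (c : SeenAll n) : Prop :=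
  (∀ j ∈ c.signers, X.Genuine ⟨j, c.epoch, c.source, c.message⟩) ∧ X.GenuineMessage c.message

theorem genuineMessage_iff : X.GenuineMessage M ↔ ∀ c ∈ M.proofs, X.GenuineProof c := by
  constructor
  · intro h c hc
    exact ⟨fun j hj => h _ (.direct M c hc hj rfl rfl rfl), fun σ hσ => h σ (.nested M c hc hσ)⟩
  · rintro h ⟨a, b, s, m⟩ hσ
    cases hσ with
    | direct _ c hc h1 h2 h3 h4 =>
      dsimp only at h1 h2 h3 h4
      subst h2 h3 h4
      exact (h c hc).1 a h1
    | nested _ c hc h1 => exact (h c hc).2 _ h1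

variable (X) in
/-- All signatures that occur in the proofs and in the current messages of the state of `p` after
`r` rounds are genuine. -/
def GenuineState (r : ℕ) (p : Fin n) : Prop :=
  (∀ c ∈ (X.state r p).proofs, X.GenuineProof c) ∧
    ∀ s M, (X.state r p).current s = some M → X.GenuineMessage M

theorem genuine_of_mem_gacSend {r : ℕ} {x : Packet n} (h : X.GenuineState r p)
    (hx : x ∈ gacSend r p (X.state r p)) {σ : Signature n} (hσ : x.HasSignature σ) :
    X.Genuine σ := by
  by_cases he : lastEpoch n < r / 3
  · simp [gacSend, he] at hx
  push Not at he
  obtain ⟨e, hr⟩ : ∃ e, r = 3 * e ∨ r = 3 * e + 1 ∨ r = 3 * e + 2 := ⟨r / 3, by omega⟩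
  rcases hr with rfl | rfl | rfl
  · rw [gacSend_own (by omega), Finset.mem_singleton] at hx
    subst hx
    exact genuineMessage_iff.2 h.1 σ hσ
  · obtain ⟨s, M, hM, rfl⟩ := (mem_gacSend_relay (by omega)).1 hx
    exact h.2 s M hM σ hσ
  · obtain ⟨s, M, hM, rfl⟩ := (mem_gacSend_signed (by omega)).1 hx
    rcases hσ with hσ | rfl | hσ
    · exact h.2 s M hM σ hσ
    · exact fun _ => hM
    · exact h.2 s M hM σ hσ

theorem genuine_of_mem_rcv {r : ℕ} (h : ∀ r' ≤ r, ∀ i ∉ X.F, X.GenuineState r' i)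
    {x : Packet n} (hx : x ∈ X.rcv r p j) {σ : Signature n} (hσ : x.HasSignature σ) :
    X.Genuine σ := by
  by_cases hj : j ∈ X.F
  · intro hF
    have hx' : x ∈ X.byz r j p := by simpa [rcv, Protocol.traffic, hj] using hx
    obtain ⟨r', hr', i', hi', j', x', hx', hσ'⟩ := X.unforgeable r j hj p x hx' σ hσ hF
    exact genuine_of_mem_gacSend (h r' hr' i' hi') hx' hσ' hF
  · rw [rcv_correct hj] at hx
    exact genuine_of_mem_gacSend (h r le_rfl j hj) hx hσ

/-- Messages delivered from genuine packets are genuine, and so are the proofs available then. -/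
theorem genuine_delivered
    (h : ∀ j, ∀ x ∈ X.rcv (3 * e + 2) p j, ∀ σ, x.HasSignature σ → X.Genuine σ) :
    (∀ s M, (X.delivered e p s).message = some M → X.GenuineMessage M) ∧
      ∀ c ∈ availableProofs (X.delivered e p), X.GenuineProof c := by
  have hmsg : ∀ s M, (X.delivered e p s).message = some M → X.GenuineMessage M := by
    intro s M hM σ hσ
    obtain ⟨j, hj⟩ := Finset.card_pos.1
      (Nat.zero_lt_of_lt (card_of_gradecastRcv3 X.resilience hM))
    exact h j _ (mem_gotSigned.1 (mem_sources.1 hj)) σ (Or.inl hσ)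
  refine ⟨hmsg, fun c hc => ?_⟩
  obtain ⟨s, hs | ⟨M, hM, hc⟩⟩ := mem_availableProofs.1 hc
  · obtain ⟨rfl, rfl, hM, hsub⟩ := of_gradecastRcv3_proof hs
    refine ⟨fun j hj => ?_, hmsg _ _ hM⟩
    exact h j _ (mem_gotSigned.1 (mem_sources.1 (hsub hj))) _ (Or.inr (Or.inl rfl))
  · exact genuineMessage_iff.1 (hmsg s M hM) c hc

theorem genuineState : ∀ (r : ℕ) (p : Fin n), p ∉ X.F → X.GenuineState r p := by
  intro r
  induction r using Nat.strong_induction_on with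
  | _ r ih =>
  intro p hp
  obtain _ | r := r
  · exact ⟨by simp [state, Protocol.run, gac, gacInit], by simp [state, Protocol.run, gac, gacInit]⟩
  have hst := ih r (Nat.lt_succ_self r) p hp
  by_cases he : lastEpoch n < r / 3
  · rwa [GenuineState, state_of_lastEpoch_lt he]
  push Not at he
  have hrcv : ∀ j, ∀ x ∈ X.rcv r p j, ∀ σ, x.HasSignature σ → X.Genuine σ := fun j x hx σ hσ =>
    genuine_of_mem_rcv (fun r' hr' => ih r' (Nat.lt_succ_of_le hr')) hx hσ
  obtain ⟨e, hr⟩ : ∃ e, r = 3 * e ∨ r = 3 * e + 1 ∨ r = 3 * e + 2 := ⟨r / 3, by omega⟩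
  rcases hr with rfl | rfl | rfl
  · rw [GenuineState, state_add_one (by omega)]
    refine ⟨hst.1, fun s M hM σ hσ => ?_⟩
    exact hrcv s _ (own_mem_of_gradecastRcv1 hM) σ hσ
  · have hst' := ih (3 * e) (by omega) p hp
    rw [GenuineState, state_add_two (by omega)]
    refine ⟨hst'.1, fun s M hM σ hσ => ?_⟩
    have hc := lt_card_sdiff (X := X) (card_of_gradecastRcv2 hM)
    obtain ⟨j, hj⟩ := Finset.card_pos.1 (Nat.zero_lt_of_lt hc)
    exact hrcv j _ (mem_gotRelay.1 (mem_sources.1 (Finset.mem_sdiff.1 hj).1)) σ hσ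
  · rw [GenuineState, show 3 * e + 2 + 1 = 3 * (e + 1) by ring, state_next (by omega)]
    simp only [gacEndEpoch_proofs, gacEndEpoch_current, List.mem_append]
    refine ⟨?_, hst.2⟩
    rintro c (hc | hc)
    · exact hst.1 c hc
    · exact (genuine_delivered hrcv).2 c (mem_availableProofs_of_mem_collectProofs hc)

theorem genuineMessage_own (hp : p ∉ X.F) : X.GenuineMessage (X.own e p) :=
  genuineMessage_iff.2 (genuineState _ p hp).1

/-- Genuine signatures of `n - f` processes on a message come from more than `f` correct processes,
so that every process has delivered the message. -/
theorem delivered_of_genuineProof {c : SeenAll n} (hc : X.GenuineProof c)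
    (hcard : n - f ≤ c.signers.card) (he : c.epoch ≤ lastEpoch n) (p : Fin n) :
    (X.delivered c.epoch p c.source).message = some c.message ∧
      0 < (X.delivered c.epoch p c.source).rank :=
  delivered_of_signed he (lt_card_sdiff (X := X) hcard)
    (fun j hj => ⟨(Finset.mem_sdiff.1 hj).2,
      hc.1 j (Finset.mem_sdiff.1 hj).1 (Finset.mem_sdiff.1 hj).2⟩) p

/-! ### The evolution of the groups -/

theorem state_zero : X.state (3 * 0) p = gacInit (X.input p) := rfl

theorem state_one :
    (X.state (3 * 1) p).pro = {X.input p} ∧ (X.state (3 * 1) p).group = [Role.slave] ∧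
      (X.state (3 * 1) p).td = 0 ∧ (X.state (3 * 1) p).tu = n ∧ (X.state (3 * 1) p).tm = n / 2 := by
  rw [state_next (Nat.zero_le _), state_add_two (Nat.zero_le _), state_zero]
  simp [gacClassify, gacInit]

/-- The two outcomes of an epoch other than the first: the process becomes a slave and keeps its
proposal, or it becomes a master and adopts the filtered set. -/
theorem classify (h1 : 1 ≤ e) (he : e ≤ lastEpoch n) (p : Fin n) :
    ((X.filtered e p).card ≤ (X.state (3 * e) p).tm ∧
      (X.state (3 * (e + 1)) p).pro = (X.state (3 * e) p).pro ∧
      (X.state (3 * (e + 1)) p).group = (X.state (3 * e) p).group ++ [Role.slave] ∧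
      (X.state (3 * (e + 1)) p).td = (X.state (3 * e) p).td ∧
      (X.state (3 * (e + 1)) p).tu = (X.state (3 * e) p).tm ∧
      (X.state (3 * (e + 1)) p).tm =
        (X.state (3 * e) p).td + ((X.state (3 * e) p).tm - (X.state (3 * e) p).td) / 2) ∨
    ((X.state (3 * e) p).tm < (X.filtered e p).card ∧
      (X.state (3 * (e + 1)) p).pro = X.filtered e p ∧
      (X.state (3 * (e + 1)) p).group = (X.state (3 * e) p).group ++ [Role.master] ∧
      (X.state (3 * (e + 1)) p).td = (X.state (3 * e) p).tm ∧
      (X.state (3 * (e + 1)) p).tu = (X.state (3 * e) p).tu ∧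
      (X.state (3 * (e + 1)) p).tm =
        (X.state (3 * e) p).tm + ((X.state (3 * e) p).tu - (X.state (3 * e) p).tm) / 2) := by
  have h0 : e ≠ 0 := by omega
  rw [state_next he, state_add_two he]
  by_cases h : (X.filtered e p).card ≤ (X.state (3 * e) p).tm
  · left
    have h' := h
    rw [filtered] at h'
    simp [gacClassify, h0, h', h]
  · right
    have h' := h
    rw [filtered] at h'
    simp [gacClassify, h0, h', not_le.1 h', filtered]

theorem exists_group_eq (he : e ≤ lastEpoch n) (p : Fin n) :
    ∃ ρ, (X.state (3 * (e + 1)) p).group = (X.state (3 * e) p).group ++ [ρ] := by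
  obtain rfl | h1 := Nat.eq_zero_or_pos e
  · exact ⟨Role.slave, state_one.2.1⟩
  · rcases X.classify h1 he p with h | h
    · exact ⟨_, h.2.2.1⟩
    · exact ⟨_, h.2.2.1⟩

theorem group_length (he : e ≤ lastEpoch n + 1) (p : Fin n) :
    (X.state (3 * e) p).group.length = e := by
  induction e with
  | zero => rfl
  | succ e ih =>
    obtain ⟨ρ, hρ⟩ := exists_group_eq (X := X) (Nat.le_of_succ_le_succ he) p
    rw [hρ, List.length_append, ih (by omega), List.length_singleton]

theorem take_group {e' : ℕ} (hee' : e ≤ e') (he' : e' ≤ lastEpoch n + 1) (p : Fin n) :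
    (X.state (3 * e') p).group.take e = (X.state (3 * e) p).group := by
  induction e', hee' using Nat.le_induction with
  | base => rw [List.take_of_length_le (group_length he' p).le]
  | succ e' hee' ih =>
    obtain ⟨ρ, hρ⟩ := exists_group_eq (X := X) (Nat.le_of_succ_le_succ he') p
    rw [hρ, List.take_append_of_le_length, ih (by omega)]
    rwa [group_length (by omega)]

/-! ### Admissible values -/

variable (X) in
/-- A value is admissible for a group if an admissibility proof for it can be given with genuine
signatures. -/
def Admissible (v : Finset (Fin n)) (G : List Role) : Prop :=
  ∃ M : Message n, X.GenuineMessage M ∧ M.Carries f v G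

theorem Admissible.of_append {v : Finset (Fin n)} {G H : List Role}
    (h : X.Admissible v (G ++ H)) : X.Admissible v G := by
  obtain ⟨M, hM, hc⟩ := h
  exact ⟨M, hM, hc.of_append⟩

/-- A seen-all proof contained in an admissibility proof shows that every process has delivered
its message in the epoch in question. -/
theorem Admissible.exists_delivered {v : Finset (Fin n)} {G : List Role} {t : ℕ}
    (h : X.Admissible v G) (ht : G[t]? = some Role.slave) (htl : t ≤ lastEpoch n) :
    ∃ s M, M.group = G.take t ∧ M.Proposes t v ∧ M.Carries f v (G.take t) ∧
      ∀ p, (X.delivered t p s).message = some M ∧ 0 < (X.delivered t p s).rank := by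
  obtain ⟨M, hM, hc⟩ := h
  obtain ⟨c, hcM, ⟨rfl, h2, h3, h4⟩, hcar⟩ := carries_iff.1 hc t ht
  exact ⟨c.source, c.message, h3, h4, hcar,
    delivered_of_genuineProof (genuineMessage_iff.1 hM c hcM) h2 htl⟩

/-- A value that is admissible for a group of slaves has passed the filter of every process of the
group from which these slaves were separated. -/
theorem Admissible.mem_filtered {v : Finset (Fin n)} {G : List Role} (h : X.Admissible v G)
    (hv : v ∈ X.E) (h1 : 1 ≤ e) (he : e ≤ lastEpoch n) (hs : G[e]? = some Role.slave)
    (hG : G.take e = (X.state (3 * e) p).group) : v ∈ X.filtered e p := by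
  obtain ⟨s, M, hg, hprop, hcar, hdel⟩ := h.exists_delivered hs he
  rw [hG] at hg hcar
  rw [Message.Proposes, if_neg (by omega)] at hprop
  exact mem_gacFilter.2 ⟨hv, s, M, (hdel p).1, (hdel p).2, hg, hprop, hcar⟩

theorem pro_subset (he : e ≤ lastEpoch n + 1) (hp : p ∉ X.F) :
    (X.state (3 * e) p).pro ⊆ X.E := by
  induction e with
  | zero => exact Finset.singleton_subset_iff.2 (X.input_mem p hp)
  | succ e ih =>
    obtain rfl | h1 := Nat.eq_zero_or_pos e
    · rw [state_one.1]
      simpa using X.input_mem p hp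
    · rcases X.classify h1 (by omega) p with h | h
      · rw [h.2.1]
        exact ih (by omega)
      · rw [h.2.1]
        exact fun v hv => (mem_gacFilter.1 hv).1

theorem own_proposes {v : Finset (Fin n)} (hv : v ∈ (X.state (3 * e) p).pro) :
    (X.own e p).Proposes e v := by
  unfold Message.Proposes
  split_ifs with h
  · subst h
    rw [state_zero] at hv
    obtain rfl := Finset.mem_singleton.1 hv
    rfl
  · exact hv

theorem own_proofs_next (he : e ≤ lastEpoch n) (p : Fin n) :
    (X.own (e + 1) p).proofs = (X.own e p).proofs ++
      collectProofs f (X.sel p (3 * e + 2)) (X.state (3 * (e + 1)) p).pro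
        (X.state (3 * (e + 1)) p).group (X.delivered e p) := by
  simp only [own, Message.proofs]
  rw [state_next he, state_add_two he]
  simp

/-- The messages of a correct process carry admissibility proofs for its proposal and its group:
as a slave it obtains a new seen-all proof from its own gradecast, as a master it takes the proofs
from the messages that have passed the filter. -/
theorem own_carries (he : e ≤ lastEpoch n + 1) (hp : p ∉ X.F) {v : Finset (Fin n)}
    (hv : v ∈ (X.state (3 * e) p).pro) : (X.own e p).Carries f v (X.state (3 * e) p).group := by
  induction e with
  | zero => exact carries_nil
  | succ e ih =>
    have he' : e ≤ lastEpoch n := Nat.le_of_succ_le_succ he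
    have ih := fun hv => ih (by omega) hv
    have hlen := group_length (X := X) (show e ≤ lastEpoch n + 1 by omega) p
    rw [carries_iff]
    intro t ht
    -- The selected proof may differ from the available one, but it is a valid one as well.
    suffices h : ∃ c, (c ∈ (X.own e p).proofs ∨ c ∈ availableProofs (X.delivered e p)) ∧
        ValidProof f v (X.state (3 * (e + 1)) p).group t c by
      rw [own_proofs_next he']
      obtain ⟨c, hc | hc, hval⟩ := h
      · exact ⟨c, List.mem_append_left _ hc, hval⟩
      · obtain ⟨c', hc', hval'⟩ :=
          exists_mem_collectProofs (sel := X.sel p (3 * e + 2)) hv ht hc hval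
        exact ⟨c', List.mem_append_right _ hc', hval'⟩
    -- This covers epoch `0` too, where every process becomes a slave.
    have hslave : (X.state (3 * (e + 1)) p).pro = (X.state (3 * e) p).pro →
        (X.state (3 * (e + 1)) p).group = (X.state (3 * e) p).group ++ [Role.slave] →
        ∃ c, (c ∈ (X.own e p).proofs ∨ c ∈ availableProofs (X.delivered e p)) ∧
          ValidProof f v (X.state (3 * (e + 1)) p).group t c := by
      intro hpro hgroup
      rw [hpro] at hv
      rw [hgroup] at ht ⊢
      have htl := (List.getElem?_eq_some_iff.1 ht).1
      rw [List.length_append, hlen, List.length_singleton] at htl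
      rcases Nat.lt_succ_iff_lt_or_eq.1 htl with hlt | rfl
      · rw [List.getElem?_append_left (by omega)] at ht
        obtain ⟨c, hc, hval⟩ := carries_iff.1 (ih hv) t ht
        exact ⟨c, Or.inl hc, (validProof_append (by omega)).2 hval⟩
      · obtain ⟨T, hT, hproof⟩ := delivered_own_proof he' hp p
        refine ⟨_, Or.inr (mem_availableProofs.2 ⟨p, Or.inl hproof⟩), ?_⟩
        rw [validProof_append hlen.ge, ValidProof, List.take_of_length_le hlen.le]
        refine ⟨⟨rfl, hT.ge, ?_, own_proposes hv⟩, ih hv⟩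
        rw [List.take_of_length_le hlen.le]
        rfl
    obtain rfl | h1 := Nat.eq_zero_or_pos e
    · exact hslave state_one.1 state_one.2.1
    rcases X.classify h1 he' p with h | h
    · exact hslave h.2.1 h.2.2.1
    · rw [h.2.1] at hv
      rw [h.2.2.1] at ht ⊢
      obtain ⟨-, s, M, hM, -, -, -, hcar⟩ := mem_gacFilter.1 hv
      have htl := (List.getElem?_eq_some_iff.1 ht).1
      rw [List.length_append, hlen, List.length_singleton] at htl
      rcases Nat.lt_succ_iff_lt_or_eq.1 htl with hlt | rfl
      · rw [List.getElem?_append_left (by omega)] at ht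
        obtain ⟨c, hc, hval⟩ := carries_iff.1 hcar t ht
        exact ⟨c, Or.inr (mem_availableProofs.2 ⟨s, Or.inr ⟨M, hM, hc⟩⟩),
          (validProof_append (by omega)).2 hval⟩
      · rw [List.getElem?_append_right hlen.le, hlen, Nat.sub_self] at ht
        cases ht

theorem admissible_of_mem_pro (he : e ≤ lastEpoch n + 1) (hp : p ∉ X.F) {v : Finset (Fin n)}
    (hv : v ∈ (X.state (3 * e) p).pro) : X.Admissible v (X.state (3 * e) p).group :=
  ⟨_, genuineMessage_own hp, own_carries he hp hv⟩

theorem pro_subset_filtered (he : e ≤ lastEpoch n) (hp : p ∉ X.F) :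
    (X.state (3 * e) p).pro ⊆ X.filtered e p := fun v hv =>
  mem_gacFilter.2 ⟨pro_subset (by omega) hp hv, p, X.own e p, (delivered_own he hp p).1,
    (delivered_own he hp p).2, rfl, hv, own_carries (by omega) hp hv⟩

theorem pro_mono {e' : ℕ} (hee' : e ≤ e') (he' : e' ≤ lastEpoch n + 1) (hp : p ∉ X.F) :
    (X.state (3 * e) p).pro ⊆ (X.state (3 * e') p).pro := by
  induction e', hee' using Nat.le_induction with
  | base => rfl
  | succ e' hee' ih =>
    refine (ih (by omega)).trans ?_
    obtain rfl | h1 := Nat.eq_zero_or_pos e'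
    · rw [state_one.1]
      rfl
    rcases X.classify h1 (by omega) p with h | h
    · rw [h.2.1]
    · rw [h.2.1]
      exact pro_subset_filtered (by omega) hp

/-! ### The thresholds -/

/-- Values that are admissible for a group of slaves were proposed alone in the first epoch. -/
theorem Admissible.exists_initial {v : Finset (Fin n)} {G : List Role} (h : X.Admissible v G)
    (hG : G[0]? = some Role.slave) (p : Fin n) :
    ∃ s M, (X.delivered 0 p s).message = some M ∧ M.proposal = {v} := by
  obtain ⟨s, M, -, hprop, -, hdel⟩ := h.exists_delivered hG (Nat.zero_le _)
  exact ⟨s, M, (hdel p).1, by simpa [Message.Proposes] using hprop⟩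

variable (X) in
/-- The values, if any, that `p` delivers in the first epoch from the senders in `S` as
proposals of a single value. -/
noncomputable def initialValues (p : Fin n) (S : Finset (Fin n)) : Finset (Finset (Fin n)) :=
  open Classical in
  X.E.filter fun v => ∃ s ∈ S, ∃ M, (X.delivered 0 p s).message = some M ∧ M.proposal = {v}

theorem card_initialValues_le (p : Fin n) (S : Finset (Fin n)) :
    (X.initialValues p S).card ≤ S.card := by
  classical
  have h : ∀ v ∈ X.initialValues p S, ∃ s ∈ S, ∃ M, (X.delivered 0 p s).message = some M ∧
      M.proposal = {v} := fun v hv => by simpa using (Finset.mem_filter.1 hv).2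
  -- A sender has only one message delivered, which proposes only one value.
  choose src hsrc msg hmsg hprop using h
  rw [← Finset.card_attach]
  refine Finset.card_le_card_of_injOn (fun v => src v.1 v.2) (fun v _ => hsrc v.1 v.2) ?_
  intro v _ w _ hvw
  have h1 := hmsg v.1 v.2
  dsimp only at hvw
  rw [hvw, hmsg w.1 w.2] at h1
  have h2 := hprop v.1 v.2
  rw [← Option.some.inj h1, hprop w.1 w.2] at h2
  exact Subtype.ext (Finset.singleton_inj.1 h2).symm

variable (X) in
/-- The allowed values that are admissible for a group. -/
noncomputable def admissibleValues (G : List Role) : Finset (Finset (Fin n)) :=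
  open Classical in X.E.filter fun v => X.Admissible v G

theorem pro_subset_admissibleValues (he : e ≤ lastEpoch n + 1) (hp : p ∉ X.F) :
    (X.state (3 * e) p).pro ⊆ X.admissibleValues (X.state (3 * e) p).group := fun v hv => by
  simpa [admissibleValues] using ⟨pro_subset he hp hv, admissible_of_mem_pro he hp hv⟩

/-- The threshold `tu` bounds the number of values that are admissible for the group: those of a
group of slaves have passed the filter of the process, and passing to a group of masters adds no
condition. -/
theorem card_admissibleValues_le (h1 : 1 ≤ e) (he : e ≤ lastEpoch n + 1) (p : Fin n) :
    (X.admissibleValues (X.state (3 * e) p).group).card ≤ (X.state (3 * e) p).tu := by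
  classical
  induction e, h1 using Nat.le_induction with
  | base =>
    rw [state_one.2.2.2.1, state_one.2.1]
    refine le_trans (Finset.card_le_card fun v hv => ?_)
      ((X.card_initialValues_le p Finset.univ).trans_eq (by simp))
    simp only [admissibleValues, Finset.mem_filter] at hv
    obtain ⟨s, M, hM, hprop⟩ := hv.2.exists_initial rfl p
    simp only [initialValues, Finset.mem_filter]
    exact ⟨hv.1, s, Finset.mem_univ s, M, hM, hprop⟩
  | succ e h1 ih =>
    have hlen := group_length (X := X) (show e ≤ lastEpoch n + 1 by omega) p
    rcases X.classify h1 (by omega) p with ⟨hcard, -, hgroup, -, htu, -⟩ | ⟨-, -, hgroup, -, htu, -⟩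
    · rw [hgroup, htu]
      refine le_trans (Finset.card_le_card fun v hv => ?_) hcard
      simp only [admissibleValues, Finset.mem_filter] at hv
      refine hv.2.mem_filtered hv.1 h1 (by omega) ?_ ?_
      · rw [List.getElem?_append_right hlen.le, hlen, Nat.sub_self]
        rfl
      · rw [List.take_append_of_le_length hlen.ge, List.take_of_length_le hlen.le]
    · rw [hgroup, htu]
      refine le_trans (Finset.card_le_card fun v hv => ?_) (ih (by omega))
      simp only [admissibleValues, Finset.mem_filter] at hv ⊢
      exact ⟨hv.1, hv.2.of_append⟩

/-- The proposal has more than `td` values, and the gap between the thresholds is halved in each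
epoch. -/
theorem thresholds (h1 : 1 ≤ e) (he : e ≤ lastEpoch n + 1) (p : Fin n) :
    (X.state (3 * e) p).td < (X.state (3 * e) p).pro.card ∧
    (X.state (3 * e) p).tm =
      (X.state (3 * e) p).td + ((X.state (3 * e) p).tu - (X.state (3 * e) p).td) / 2 ∧
    (X.state (3 * e) p).tu - (X.state (3 * e) p).td ≤ 2 ^ (lastEpoch n + 1 - e) := by
  induction e, h1 using Nat.le_induction with
  | base =>
    obtain ⟨hpro, -, htd, htu, htm⟩ := state_one (X := X) (p := p)
    rw [hpro, htd, htu, htm]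
    refine ⟨by simp, by simp, ?_⟩
    exact (Nat.lt_pow_succ_log_self one_lt_two n).le
  | succ e h1 ih =>
    obtain ⟨ih1, ih2, ih3⟩ := ih (by omega)
    rw [show lastEpoch n + 1 - e = (lastEpoch n + 1 - (e + 1)) + 1 by omega, pow_succ] at ih3
    rcases X.classify h1 (by omega) p with ⟨hcard, hpro, -, htd, htu, htm⟩ |
      ⟨hcard, hpro, -, htd, htu, htm⟩
    · rw [hpro, htd, htu, htm]
      refine ⟨ih1, rfl, by omega⟩
    · rw [hpro, htd, htu, htm]
      refine ⟨hcard, rfl, by omega⟩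

/-! ### Agreement -/

variable (X) in
/-- The proposal of process `p` after the last epoch. -/
noncomputable def finalPro (p : Fin n) : Finset (Finset (Fin n)) :=
  (X.state (3 * (lastEpoch n + 1)) p).pro

/-- In the end the gap between the thresholds is at most one, so that the proposal consists of all
the values that are admissible for the group. -/
theorem finalPro_eq (hp : p ∉ X.F) :
    X.finalPro p = X.admissibleValues (X.state (3 * (lastEpoch n + 1)) p).group := by
  refine Finset.eq_of_subset_of_card_le (pro_subset_admissibleValues le_rfl hp) ?_
  have h1 := X.card_admissibleValues_le (Nat.le_add_left _ _) le_rfl p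
  obtain ⟨h2, -, h3⟩ := X.thresholds (Nat.le_add_left _ _) le_rfl p
  rw [Nat.sub_self, pow_zero] at h3
  rw [finalPro]
  omega

/-- If the groups of two processes first differ at the end of epoch `e`, the final proposal of the
slave is contained in that of the master, since what is admissible for the slave's group has
passed the master's filter. -/
theorem finalPro_subset_of_slave_of_master (h1 : 1 ≤ e) (he : e ≤ lastEpoch n) (hp : p ∉ X.F)
    (hq : q ∉ X.F) (hG : (X.state (3 * e) p).group = (X.state (3 * e) q).group)
    (hps : (X.state (3 * (e + 1)) p).group = (X.state (3 * e) p).group ++ [Role.slave])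
    (hqm : (X.state (3 * (e + 1)) q).pro = X.filtered e q) : X.finalPro p ⊆ X.finalPro q := by
  intro v hv
  refine pro_mono (show e + 1 ≤ lastEpoch n + 1 by omega) le_rfl hq ?_
  rw [hqm]
  have hlen := group_length (X := X) (show e ≤ lastEpoch n + 1 by omega) p
  refine (admissible_of_mem_pro le_rfl hp hv).mem_filtered (pro_subset le_rfl hp hv) h1 he ?_ ?_
  · have ht := take_group (X := X) (show e + 1 ≤ lastEpoch n + 1 by omega) le_rfl p
    rw [← List.getElem?_take_of_lt (Nat.lt_succ_self e), ht, hps,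
      List.getElem?_append_right hlen.le, hlen, Nat.sub_self]
    rfl
  · rw [take_group (by omega) le_rfl, hG]

theorem finalPro_comparable (hp : p ∉ X.F) (hq : q ∉ X.F) :
    X.finalPro p ⊆ X.finalPro q ∨ X.finalPro q ⊆ X.finalPro p := by
  by_cases hfin : (X.state (3 * (lastEpoch n + 1)) p).group =
      (X.state (3 * (lastEpoch n + 1)) q).group
  · left
    rw [finalPro_eq hp, finalPro_eq hq, hfin]
  suffices h : ∀ e, e ≤ lastEpoch n + 1 →
      (X.state (3 * e) p).group ≠ (X.state (3 * e) q).group →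
      X.finalPro p ⊆ X.finalPro q ∨ X.finalPro q ⊆ X.finalPro p from h _ le_rfl hfin
  intro e
  induction e with
  | zero => exact fun _ h => absurd rfl h
  | succ e ih =>
    intro he hne
    by_cases hG : (X.state (3 * e) p).group = (X.state (3 * e) q).group
    swap
    · exact ih (by omega) hG
    obtain rfl | h1 := Nat.eq_zero_or_pos e
    · exact absurd (state_one.2.1.trans state_one.2.1.symm) hne
    rcases X.classify h1 (by omega) p with ⟨-, hp1, hp2, -⟩ | ⟨-, hp1, hp2, -⟩ <;>
      rcases X.classify h1 (by omega) q with ⟨-, hq1, hq2, -⟩ | ⟨-, hq1, hq2, -⟩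
    · exact absurd (by rw [hp2, hq2, hG]) hne
    · exact Or.inl (finalPro_subset_of_slave_of_master h1 (by omega) hp hq hG hp2 hq1)
    · exact Or.inr (finalPro_subset_of_slave_of_master h1 (by omega) hq hp hG.symm hq2 hp1)
    · exact absurd (by rw [hp2, hq2, hG]) hne

theorem input_mem_finalPro (hp : p ∉ X.F) : X.input p ∈ X.finalPro p :=
  pro_mono (Nat.zero_le _) le_rfl hp (Finset.mem_singleton_self _)

theorem finalPro_subset_initialValues (hp : p ∉ X.F) (q : Fin n) :
    X.finalPro p ⊆ X.Fᶜ.image X.input ∪ X.initialValues q X.F := by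
  classical
  intro v hv
  have hG : (X.state (3 * (lastEpoch n + 1)) p).group[0]? = some Role.slave := by
    have ht := take_group (X := X) (show 1 ≤ lastEpoch n + 1 by omega) le_rfl p
    rw [← List.getElem?_take_of_lt Nat.zero_lt_one, ht, state_one.2.1]
    rfl
  obtain ⟨s, M, hM, hprop⟩ := (admissible_of_mem_pro le_rfl hp hv).exists_initial hG q
  rw [Finset.mem_union]
  by_cases hs : s ∈ X.F
  · right
    simp only [initialValues, Finset.mem_filter]
    exact ⟨pro_subset le_rfl hp hv, s, hs, M, hM, hprop⟩
  · left
    rw [(delivered_own (Nat.zero_le _) hs q).1] at hM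
    obtain rfl := Option.some.inj hM
    refine Finset.mem_image.2 ⟨s, Finset.mem_compl.2 hs, ?_⟩
    exact Finset.singleton_inj.1 hprop

/-! ### Decisions -/

theorem decision_eq (r : ℕ) (p : Fin n) : (X.state r p).decision =
    if 3 * (lastEpoch n + 1) ≤ r then some ((X.finalPro p).sup id) else none := by
  induction r with
  | zero => rfl
  | succ r ih =>
    by_cases he : lastEpoch n < r / 3
    · rw [state_of_lastEpoch_lt he, ih, if_pos (by omega), if_pos (by omega)]
    rw [if_neg (by omega)] at ih
    obtain ⟨e, hr⟩ : ∃ e, r = 3 * e ∨ r = 3 * e + 1 ∨ r = 3 * e + 2 := ⟨r / 3, by omega⟩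
    rcases hr with rfl | rfl | rfl
    · rw [state_add_one (by omega), if_neg (by omega)]
      exact ih
    · rw [state_add_one (by omega)] at ih
      rw [state_add_two (by omega), if_neg (by omega)]
      exact ih
    · rw [show 3 * e + 2 + 1 = 3 * (e + 1) by ring]
      by_cases hl : e = lastEpoch n
      · subst hl
        rw [if_pos le_rfl, finalPro, state_next le_rfl, gacEndEpoch_decision, if_pos rfl,
          gacEndEpoch_pro]
      · rw [if_neg (by omega), state_next (by omega), gacEndEpoch_decision, if_neg hl, ih]

theorem isLatticeAgreement (X : Execution n f) :
    IsLatticeAgreement X.E X.F X.input (fun r p => (X.state r p).decision) := by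
  have hdec : ∀ p r d, (X.state r p).decision = some d → d = (X.finalPro p).sup id := by
    intro p r d h
    rw [decision_eq] at h
    split_ifs at h
    exact (Option.some.inj h).symm
  refine ⟨fun p _ => ⟨_, _, by rw [decision_eq, if_pos le_rfl]⟩, ?_, ?_, ?_, ?_⟩
  · intro p _ r r' d hrr' h
    rw [hdec p r d h]
    rw [decision_eq] at h ⊢
    split_ifs at h
    rw [if_pos (by omega)]
  · intro p hp q hq r r' d d' h h'
    rw [hdec p r d h, hdec q r' d' h']
    exact (finalPro_comparable hp hq).imp Finset.sup_mono Finset.sup_mono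
  · intro p hp r d h
    rw [hdec p r d h]
    exact Finset.le_sup (f := id) (input_mem_finalPro hp)
  · obtain ⟨q⟩ : Nonempty (Fin n) := ⟨⟨0, by have := X.resilience; omega⟩⟩
    refine ⟨X.initialValues q X.F, Finset.filter_subset _ _, X.card_initialValues_le q X.F, ?_⟩
    intro p hp r d h
    rw [hdec p r d h]
    exact Finset.sup_mono (by convert finalPro_subset_initialValues hp q)

end Execution

theorem isBigO_rounds :
    (fun n : ℕ => ((3 * (lastEpoch n + 1) : ℕ) : ℝ)) =O[Filter.atTop]
      fun n : ℕ => Real.log (n : ℝ) := by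
  have hlog2 : 0 < Real.log 2 := Real.log_pos one_lt_two
  refine Asymptotics.IsBigO.of_bound (9 / Real.log 2) ?_
  filter_upwards [Filter.eventually_ge_atTop 2] with n hn
  have h2 : Real.log 2 ≤ Real.log n := Real.log_le_log two_pos (by exact_mod_cast hn)
  have h1 : (Nat.log 2 n : ℝ) * Real.log 2 ≤ Real.log n := by
    rw [← Real.log_pow]
    refine Real.log_le_log (by positivity) ?_
    exact_mod_cast Nat.pow_log_le_self 2 (by omega)
  rw [Real.norm_of_nonneg (by positivity), Real.norm_of_nonneg (hlog2.le.trans h2),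
    div_mul_eq_mul_div, le_div_iff₀ hlog2, lastEpoch]
  push_cast
  nlinarith

end ByzLA

theorem mainTheorem2 :
    ∃ T : ℕ → ℕ,
      ((fun n : ℕ => (T n : ℝ)) =O[Filter.atTop] fun n : ℕ => Real.log (n : ℝ)) ∧
      ∀ (n f : ℕ), 3 * f + 1 ≤ n →
      ∀ (E : Finset (Finset (Fin n))) (sel : Fin n → ℕ → ByzLA.Selector)
        (F : Finset (Fin n)), F.card ≤ f →
      ∀ (input : Fin n → Finset (Fin n)), (∀ p ∉ F, input p ∈ E) →
      ∀ (byz : ℕ → Fin n → Fin n → Finset (ByzLA.Packet n)),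
        ByzLA.Unforgeable (ByzLA.gac n f E sel) F byz input →
        ByzLA.IsLatticeAgreement E F input
          (fun r p => (ByzLA.gac n f E sel).output ((ByzLA.gac n f E sel).run F byz input r p)) ∧
        ∀ p ∉ F, ∃ d,
          (ByzLA.gac n f E sel).output ((ByzLA.gac n f E sel).run F byz input (T n) p) =
            some d := by
  refine ⟨fun n => 3 * (ByzLA.lastEpoch n + 1), ByzLA.isBigO_rounds, ?_⟩
  intro n f hn E sel F hF input hinput byz hbyz
  let X : ByzLA.Execution n f := ⟨E, sel, F, input, byz, hn, hF, hinput, hbyz⟩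
  refine ⟨X.isLatticeAgreement, fun p _ => ⟨(X.finalPro p).sup id, ?_⟩⟩
  exact (X.decision_eq _ p).trans (if_pos le_rfl)
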